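/- Let $G=(V,E)$ be a finite simple graph with a fixed total order on its edge set $E$, and let $\mathfrak S_V$ be the symmetric group of $V$. **Chromatic symmetric functor.** For a finite nonempty set $B$ with $b$ elements let $S_B=\{f\in\mathbb C^B:\sum_{v\in B}f(v)=0\}\cong S^{(b-1,1)}$ and let $L_B=\bigwedge^*S_B$, a graded $\mathbb C[\mathfrak S_B]$-module. For $T\subseteq E$ let $B_1,\dots,B_r$ be the vertex sets of the connected components of the spanning subgraph $(V,T)$, and put $$\mathcal M_T=\operatorname{Ind}_{\mathfrak S_{B_1}\times\dots\times\mathfrak S_{B_r}}^{\mathfrak S_V}\bigl(L_{B_1}\otimes\dots\otimes L_{B_r}\bigr),$$ where $\otimes$ is the graded tensor product of exterior algebras, so that $L_{B_1}\otimes\dots\otimes L_{B_r}=\bigwedge^*(S_{B_1}\oplus\dots\oplus S_{B_r})$. If $T\subseteq T'$, every component of $T$ lies in a component of $T'$, so $\bigoplus_i S_{B_i}\subseteq\bigoplus_k S_{B'_k}$ inside $\mathbb C^V$, and the inclusion induces a map $\bigotimes_i L_{B_i}\to\bigotimes_k L_{B'_k}$ and hence a degree-preserving $\mathfrak S_V$-map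 $\mathcal M_T\to\mathcal M_{T'}$. (When $T'=T\cup\{e\}$ this is the identity if $e$ completes a cycle in $T$; if $e$ joins two components $A$ and $B$ of $T$, it is induced by the inclusion of $L_A\otimes L_B$ into the restriction of $L_{A\cup B}$.) This defines the chromatic symmetric functor $F^{CS}=F^{CS}_G$ from the Boolean lattice $2^E$ to graded $\mathbb C[\mathfrak S_V]$-modules. **Cohomology.** For $T\subseteq E$ and $e\in E\setminus T$ put $c(T\lessdot T\cup\{e\})=(-1)^{\#\{f\in T:\,f<e\}}$. For a lower order ideal $\mathcal I\subseteq 2^E$, let $H^*(F^{CS}|_{\mathcal I})$ be the cohomology of the cochain complex of graded $\mathbb C[\mathfrak S_V]$-modules $$C^k=\bigoplus_{T\in\mathcal I,\ |T|=k}F^{CS}(T),\qquad \delta^k=\sum_{T\lessdot T'\text{ in }\mathcal I,\ |T|=k}c(T\lessdot T')\,F^{CS}(T\lessdot T').$$ For $\mathcal I=2^E$ this is the chromatic symmetric homology $H^*(F^{CS}_G)$ of Sazdanović and Yip. **Broken circuits.** A broken circuit is a set $C\setminus\{e\}$, where $C\subseteq E$ is the edge set of a cycle of $G$ and $e$ is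 the largest edge of $C$. Let $\mathrm{NBC}\subseteq 2^E$ be the lower order ideal of all $S\subseteq E$ that contain no broken circuit. **Theorem.** For every such $G$ and every total order on $E$, $$H^i(F^{CS}_G)\cong H^i\bigl(F^{CS}_G|_{\mathrm{NBC}}\bigr)\quad\text{for all } i\ge 0,$$ as graded $\mathbb C[\mathfrak S_V]$-modules. -/

import Mathlib

open CategoryTheory CategoryTheory.Limits
open scoped TensorProduct

universe w v u

/-! ### Cohomology of functors on thin posets -/

/-- A graded poset (with rank function `grade ℕ`) is *thin* if every closed interval `[x, y]`
with `rk y = rk x + 2` has exactly four elements. -/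
class IsThinPoset (P : Type w) [PartialOrder P] [GradeOrder ℕ P] : Prop where
  ncard_Icc : ∀ x y : P, x ≤ y → grade ℕ y = grade ℕ x + 2 → (Set.Icc x y).ncard = 4

/-- A *balanced coloring*: a sign for every cover relation such that in each diamond
`{x, a, b, y}` an odd number of the four cover relations carries the sign `-1`, that is, the
product of the four signs is `-1`. -/
structure BalancedColoring (P : Type w) [PartialOrder P] where
  sign : ∀ x y : P, x ⋖ y → ℤˣ
  balanced : ∀ (x a b y : P) (hxa : x ⋖ a) (hay : a ⋖ y) (hxb : x ⋖ b) (hby : b ⋖ y), a ≠ b →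
    sign x a hxa * sign a y hay * (sign x b hxb * sign b y hby) = -1

/-- The elements of rank `k`. -/
abbrev RankLevel (P : Type w) [PartialOrder P] [GradeOrder ℕ P] (k : ℕ) : Type w :=
  {x : P // grade ℕ x = k}

theorem IsThinPoset.exists_two_mid {P : Type w} [PartialOrder P] [GradeOrder ℕ P]
    [IsThinPoset P] {x y : P} (hxy : x ≤ y) (h : grade ℕ y = grade ℕ x + 2) :
    ∃ a b : P, a ≠ b ∧ x ⋖ a ∧ a ⋖ y ∧ x ⋖ b ∧ b ⋖ y ∧ ∀ z, x ⋖ z → z ⋖ y → z = a ∨ z = b := by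
  have h4 := IsThinPoset.ncard_Icc x y hxy h
  have hne : x ≠ y := by rintro rfl; omega
  have hsub : ({x, y} : Set P) ⊆ Set.Icc x y := by
    rintro z (rfl | rfl)
    · exact ⟨le_rfl, hxy⟩
    · exact ⟨hxy, le_rfl⟩
  have h2 : (Set.Icc x y \ {x, y}).ncard = 2 := by
    rw [Set.ncard_sdiff hsub (by simp), h4, Set.ncard_pair hne]
  obtain ⟨a, b, hab, hS⟩ := Set.ncard_eq_two.mp h2
  have key : ∀ z, z ∈ Set.Icc x y \ {x, y} → x ⋖ z ∧ z ⋖ y := by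
    rintro z ⟨⟨hxz, hzy⟩, hz⟩
    have hz1 : z ≠ x := fun e => hz (by simp [e])
    have hz2 : z ≠ y := fun e => hz (by simp [e])
    have l1 : x < z := lt_of_le_of_ne hxz (Ne.symm hz1)
    have l2 : z < y := lt_of_le_of_ne hzy hz2
    have g1 := grade_strictMono (𝕆 := ℕ) l1
    have g2 := grade_strictMono (𝕆 := ℕ) l2
    constructor
    · rw [covBy_iff_lt_covBy_grade (𝕆 := ℕ), Nat.covBy_iff_add_one_eq]
      exact ⟨l1, by omega⟩
    · rw [covBy_iff_lt_covBy_grade (𝕆 := ℕ), Nat.covBy_iff_add_one_eq]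
      exact ⟨l2, by omega⟩
  have ha := key a (by rw [hS]; simp)
  have hb := key b (by rw [hS]; simp)
  refine ⟨a, b, hab, ha.1, ha.2, hb.1, hb.2, fun z h1 h2 => ?_⟩
  have : z ∈ Set.Icc x y \ {x, y} := by
    refine ⟨⟨h1.le, h2.le⟩, ?_⟩
    rintro (rfl | rfl)
    · exact h1.lt.false
    · exact h2.lt.false
  rw [hS] at this
  simpa using this

noncomputable section PosetCohomology

attribute [local instance] CategoryTheory.Abelian.hasFiniteBiproducts

variable {P : Type w} [PartialOrder P] [GradeOrder ℕ P] [Finite P]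
  {A : Type u} [Category.{v} A] [Abelian A]

open scoped Classical in
/-- The matrix entry of the differential from the summand `F x` to the summand `F y`:
`c (x ⋖ y) F (x ⋖ y)` if `x ⋖ y`, and zero otherwise. -/
def posetEntry (F : P ⥤ A) (c : BalancedColoring P) (x y : P) : F.obj x ⟶ F.obj y :=
  if h : x ⋖ y then ((c.sign x y h : ℤˣ) : ℤ) • F.map (homOfLE h.le) else 0

/-- `C^k(F, c) = ⨁_{rk x = k} F x`. -/
abbrev posetCochains (F : P ⥤ A) (k : ℕ) : A :=
  ⨁ (fun x : RankLevel P k => F.obj x.1)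

/-- `δ^k = ∑_{x ⋖ y, rk x = k} c (x ⋖ y) F (x ⋖ y)`. -/
def posetDifferential (F : P ⥤ A) (c : BalancedColoring P) (k : ℕ) :
    posetCochains F k ⟶ posetCochains F (k + 1) :=
  biproduct.desc fun x : RankLevel P k =>
    biproduct.lift fun y : RankLevel P (k + 1) => posetEntry F c x.1 y.1

theorem biproduct_lift_desc_eq_sum {J : Type w} [Fintype J] {f : J → A} {X Y : A}
    (g : ∀ j, X ⟶ f j) (h : ∀ j, f j ⟶ Y) :
    biproduct.lift g ≫ biproduct.desc h = ∑ j, g j ≫ h j := by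
  have ht : ∑ j, biproduct.π f j ≫ biproduct.ι f j = 𝟙 (⨁ f) :=
    IsBilimit.total (biproduct.isBilimit f)
  rw [← Category.id_comp (biproduct.desc h), ← ht, Preadditive.sum_comp, Preadditive.comp_sum]
  simp

theorem posetDifferential_comp [IsThinPoset P] (F : P ⥤ A) (c : BalancedColoring P) (k : ℕ) :
    posetDifferential F c k ≫ posetDifferential F c (k + 1) = 0 := by
  classical
  have : Fintype (RankLevel P (k + 1)) := Fintype.ofFinite _
  apply biproduct.hom_ext'
  intro x
  apply biproduct.hom_ext
  intro y
  simp only [posetDifferential, biproduct.ι_desc_assoc, comp_zero, zero_comp, Category.assoc]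
  rw [← Category.assoc, biproduct_lift_desc_eq_sum, Preadditive.sum_comp]
  simp only [Category.assoc, biproduct.lift_π]
  by_cases hxy : x.1 ≤ y.1
  · obtain ⟨a, b, hab, hxa, hay, hxb, hby, hz⟩ :=
      IsThinPoset.exists_two_mid hxy (by rw [x.2, y.2])
    have ga : grade ℕ a = k + 1 := by
      have := (covBy_iff_lt_covBy_grade (𝕆 := ℕ)).1 hxa
      rw [Nat.covBy_iff_add_one_eq, x.2] at this
      omega
    have gb : grade ℕ b = k + 1 := by
      have := (covBy_iff_lt_covBy_grade (𝕆 := ℕ)).1 hxb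
      rw [Nat.covBy_iff_add_one_eq, x.2] at this
      omega
    have hab' : (⟨a, ga⟩ : RankLevel P (k + 1)) ≠ ⟨b, gb⟩ := fun e => hab (congrArg Subtype.val e)
    rw [Fintype.sum_eq_add ⟨a, ga⟩ ⟨b, gb⟩ hab']
    · have hc := c.balanced x.1 a b y.1 hxa hay hxb hby hab
      simp only [posetEntry, hxa, hay, hxb, hby, dif_pos, Preadditive.zsmul_comp,
        Preadditive.comp_zsmul, smul_smul, ← F.map_comp, homOfLE_comp]
      rw [← add_smul]
      have : ((c.sign a y.1 hay : ℤˣ) : ℤ) * ((c.sign x.1 a hxa : ℤˣ) : ℤ)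
          + ((c.sign b y.1 hby : ℤˣ) : ℤ) * ((c.sign x.1 b hxb : ℤˣ) : ℤ) = 0 := by
        rcases Int.units_eq_one_or (c.sign a y.1 hay) with h1 | h1 <;>
        rcases Int.units_eq_one_or (c.sign x.1 a hxa) with h2 | h2 <;>
        rcases Int.units_eq_one_or (c.sign b y.1 hby) with h3 | h3 <;>
        rcases Int.units_eq_one_or (c.sign x.1 b hxb) with h4 | h4 <;>
        rw [h1, h2, h3, h4] at hc ⊢ <;> revert hc <;> decide
      rw [this, zero_smul]
    · rintro z ⟨hza, hzb⟩
      by_cases h1 : x.1 ⋖ z.1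
      · by_cases h2 : z.1 ⋖ y.1
        · rcases hz z.1 h1 h2 with h | h
          · exact absurd (Subtype.ext h) hza
          · exact absurd (Subtype.ext h) hzb
        · simp [posetEntry, h2]
      · simp [posetEntry, h1]
  · apply Finset.sum_eq_zero
    intro z _
    by_cases h1 : x.1 ⋖ z.1
    · by_cases h2 : z.1 ⋖ y.1
      · exact absurd (h1.le.trans h2.le) hxy
      · simp [posetEntry, h2]
    · simp [posetEntry, h1]

/-- The cochain complex `C^*(F, c)` of a functor `F` on a finite thin poset with balanced
coloring `c`. -/
def posetComplex [IsThinPoset P] (F : P ⥤ A) (c : BalancedColoring P) : CochainComplex A ℕ :=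
  CochainComplex.of (posetCochains F) (posetDifferential F c) (posetDifferential_comp F c)

/-- The cohomology `H^k(F, c)`. -/
def posetCohomology [IsThinPoset P] (F : P ⥤ A) (c : BalancedColoring P) (k : ℕ) : A :=
  (posetComplex F c).homology k

end PosetCohomology

/-! ### Restriction to a lower order ideal -/

section LowerIdeal

variable {P : Type w} [PartialOrder P]

theorem LowerSet.covBy_coe (I : LowerSet P) {x y : I} (h : x ⋖ y) : x.1 ⋖ y.1 :=
  ⟨h.lt, fun z hxz hzy => h.2 (c := ⟨z, I.lower hzy.le y.2⟩) hxz hzy⟩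

instance LowerSet.instGradeOrderNat [GradeOrder ℕ P] (I : LowerSet P) : GradeOrder ℕ I where
  grade x := grade ℕ x.1
  grade_strictMono _ _ h := grade_strictMono (𝕆 := ℕ) (α := P) h
  covBy_grade _ _ h := (I.covBy_coe h).grade ℕ

instance LowerSet.instIsThinPoset [GradeOrder ℕ P] [IsThinPoset P] (I : LowerSet P) :
    IsThinPoset I where
  ncard_Icc x y hxy h := by
    rw [← IsThinPoset.ncard_Icc x.1 y.1 hxy h,
      ← Set.ncard_image_of_injective (Set.Icc x y) Subtype.val_injective]
    congr 1
    ext z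
    constructor
    · rintro ⟨z, hz, rfl⟩
      exact hz
    · intro hz
      exact ⟨⟨z, I.lower hz.2 y.2⟩, hz, rfl⟩

/-- The restriction of a balanced coloring to a lower order ideal. -/
def BalancedColoring.restrict (c : BalancedColoring P) (I : LowerSet P) : BalancedColoring I where
  sign x y h := c.sign x.1 y.1 (I.covBy_coe h)
  balanced x a b y _ _ _ _ hab :=
    c.balanced x.1 a.1 b.1 y.1 _ _ _ _ fun e => hab (Subtype.ext e)

/-- The restriction `F|_I` of a functor on a poset to a lower order ideal. -/
def restrictToLowerSet {A : Type u} [Category.{v} A] (F : P ⥤ A) (I : LowerSet P) : I ⥤ A :=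
  (Subtype.mono_coe (fun x : P => x ∈ I)).functor ⋙ F

end LowerIdeal

/-! ### The Boolean lattice of a finite ordered set -/

section BooleanLattice

instance Finset.instIsThinPoset {α : Type w} : IsThinPoset (Finset α) where
  ncard_Icc s t hst h := by
    classical
    rw [← Finset.coe_Icc, Set.ncard_coe_finset, Finset.card_Icc_finset hst]
    simp only [Finset.grade_eq] at h
    rw [h]
    simp

/-- The standard coloring of the Boolean lattice `2^E` of an ordered set `E`: the cover relation
`S ⋖ S ∪ {i}` has the sign `(-1) ^ #{j ∈ S | j < i}`. -/
def booleanColoring {α : Type w} (ord : LinearOrder α) : BalancedColoring (Finset α) where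
  sign S T _ := ∏ i ∈ T \ S, (-1) ^ (S.filter (fun j => j < i)).card
  balanced S A B T hSA hAT hSB hBT hAB := by
    obtain ⟨a, ha, rfl⟩ := Finset.covBy_iff_exists_insert.1 hSA
    obtain ⟨b, hb, rfl⟩ := Finset.covBy_iff_exists_insert.1 hSB
    have hab : a ≠ b := fun e => hAB (by rw [e])
    have hT : T = insert b (insert a S) := by
      obtain ⟨x, hx, rfl⟩ := Finset.covBy_iff_exists_insert.1 hAT
      have hbm : b ∈ insert x (insert a S) := hBT.le (Finset.mem_insert_self b S)
      simp only [Finset.mem_insert, hb, or_false] at hbm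
      rcases hbm with h | h
      · rw [h]
      · exact absurd h.symm hab
    subst hT
    have e1 : insert a S \ S = {a} := by ext z; simp; grind
    have e2 : insert b S \ S = {b} := by ext z; simp; grind
    have e3 : insert b (insert a S) \ insert a S = {b} := by ext z; simp; grind
    have e4 : insert b (insert a S) \ insert b S = {a} := by ext z; simp; grind
    rw [e1, e2, e3, e4]
    simp only [Finset.prod_singleton, Finset.filter_insert]
    have hfa : ∀ p : α → Prop, [DecidablePred p] → a ∉ S.filter p := by
      intro p _; simp [ha]
    have hfb : ∀ p : α → Prop, [DecidablePred p] → b ∉ S.filter p := by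
      intro p _; simp [hb]
    rcases lt_or_gt_of_ne hab with h | h
    · rw [if_pos h, if_neg h.not_gt, Finset.card_insert_of_notMem (hfa _), pow_succ]
      rcases neg_one_pow_eq_or ℤˣ (S.filter (fun j => j < a)).card with h1 | h1 <;>
      rcases neg_one_pow_eq_or ℤˣ (S.filter (fun j => j < b)).card with h2 | h2 <;>
      rw [h1, h2] <;> decide
    · rw [if_neg h.not_gt, if_pos h, Finset.card_insert_of_notMem (hfb _), pow_succ]
      rcases neg_one_pow_eq_or ℤˣ (S.filter (fun j => j < a)).card with h1 | h1 <;>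
      rcases neg_one_pow_eq_or ℤˣ (S.filter (fun j => j < b)).card with h2 | h2 <;>
      rw [h1, h2] <;> decide

end BooleanLattice

/-! ### Broken circuits -/

namespace SimpleGraph

variable {V : Type u} (G : SimpleGraph V)

/-- `C` is the edge set of a cycle of `G`. -/
def IsCycleEdgeSet (C : Finset G.edgeSet) : Prop :=
  ∃ (x : V) (p : G.Walk x x), p.IsCycle ∧ ∀ f : G.edgeSet, f ∈ C ↔ (f : Sym2 V) ∈ p.edges

/-- A broken circuit: `C \ {e}`, where `C` is a cycle and `e` is the largest edge of `C`. -/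
def IsBrokenCircuit (ord : LinearOrder G.edgeSet) (B : Finset G.edgeSet) : Prop :=
  ∃ (C : Finset G.edgeSet) (e : G.edgeSet), G.IsCycleEdgeSet C ∧ e ∈ C ∧ (∀ f ∈ C, ord.le f e) ∧
    ∀ f, f ∈ B ↔ f ∈ C ∧ f ≠ e

/-- `NBC`: the edge subsets that contain no broken circuit, a lower order ideal in `2^E`. -/
def nbc (ord : LinearOrder G.edgeSet) : LowerSet (Finset G.edgeSet) where
  carrier := {S | ∀ B, G.IsBrokenCircuit ord B → ¬ B ⊆ S}
  lower' _ _ hTS hS B hB hBT := hS B hB (hBT.trans hTS)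

/-- The partition of the vertex set into the connected components of the spanning subgraph with
edge set `T`. -/
def componentSetoid (T : Finset G.edgeSet) : Setoid V :=
  (SimpleGraph.fromEdgeSet ((fun e : G.edgeSet => (e : Sym2 V)) '' (T : Set G.edgeSet))).reachableSetoid

theorem componentSetoid_mono : Monotone G.componentSetoid := fun _ _ hST _ _ h =>
  SimpleGraph.Reachable.mono
    (SimpleGraph.fromEdgeSet_mono (Set.image_mono (Finset.coe_subset.2 hST))) h

end SimpleGraph

/-! ### The chromatic symmetric functor -/

noncomputable section ChromaticSymmetric

open Representation

variable {V : Type u}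

/-- The Young subgroup `∏_B 𝔖_B` of the symmetric group of `V`, for the partition of `V` into the
classes `B` of `π`: the permutations that map every block to itself. -/
def youngSubgroup (π : Setoid V) : Subgroup (Equiv.Perm V) where
  carrier := {g | ∀ x, π (g x) x}
  one_mem' x := π.refl x
  mul_mem' {g h} hg hh x := π.trans (hg (h x)) (hh x)
  inv_mem' {g} hg x := by
    have := hg (g⁻¹ x)
    rw [← Equiv.Perm.mul_apply, mul_inv_cancel] at this
    exact π.symm this

theorem youngSubgroup_mono {π σ : Setoid V} (h : π ≤ σ) : youngSubgroup π ≤ youngSubgroup σ :=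
  fun _ hg x => h (hg x)

variable [Fintype V]

open scoped Classical in
/-- `⨁_B S^{(b-1,1)}`, the direct sum over the blocks `B` of `π`, of size `b`, of the standard
representations `S^{(b-1,1)} = {f ∈ ℂ^B | ∑_{v ∈ B} f v = 0}` of `𝔖_B`. It is written as
a subspace of `ℂ^V = ⨁_B ℂ^B`. -/
def blockStd (π : Setoid V) : Submodule ℂ (V → ℂ) where
  carrier := {f | ∀ x, ∑ y with π y x, f y = 0}
  zero_mem' x := by simp
  add_mem' hf hg x := by simp [Finset.sum_add_distrib, hf x, hg x]
  smul_mem' a f hf x := by simp [← Finset.mul_sum, hf x]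

theorem blockStd_mono {π σ : Setoid V} (h : π ≤ σ) : blockStd π ≤ blockStd σ := by
  classical
  intro f hf x
  let _ : Fintype (Quotient π) := Fintype.ofFinite _
  rw [← Finset.sum_fiberwise (s := Finset.univ.filter fun y => σ y x)
    (g := fun y => (Quotient.mk π y))]
  refine Finset.sum_eq_zero fun q _ => ?_
  induction q using Quotient.inductionOn with
  | h z =>
    by_cases hz : σ z x
    · rw [← hf z]
      refine Finset.sum_congr ?_ fun _ _ => rfl
      ext y
      simp only [Finset.mem_filter, Finset.mem_univ, true_and]
      constructor
      · rintro ⟨_, h2⟩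
        exact Quotient.exact h2
      · intro hy
        exact ⟨σ.trans (h hy) hz, Quotient.sound hy⟩
    · apply Finset.sum_eq_zero
      intro y hy
      simp only [Finset.mem_filter, Finset.mem_univ, true_and] at hy
      exact absurd (σ.trans (σ.symm (h (Quotient.exact hy.2))) hy.1) hz

theorem blockStd_stable (π : Setoid V) (g : youngSubgroup π) (f : V → ℂ) (hf : f ∈ blockStd π) :
    LinearMap.funLeft ℂ ℂ (⇑(g.1⁻¹)) f ∈ blockStd π := by
  classical
  intro x
  rw [← hf x]
  refine Finset.sum_equiv g.1⁻¹ ?_ fun _ _ => rfl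
  intro y
  simp only [Finset.mem_filter, Finset.mem_univ, true_and]
  have := (youngSubgroup π).inv_mem g.2 y
  exact ⟨fun h => π.trans this h, fun h => π.trans (π.symm this) h⟩

/-- The Young subgroup acts on `⨁_B S^{(b-1,1)}` by `(g f) v = f (g⁻¹ v)`. -/
def blockStdRep (π : Setoid V) : Representation ℂ (youngSubgroup π) (blockStd π) where
  toFun g := (LinearMap.funLeft ℂ ℂ (⇑(g.1⁻¹))).restrict (blockStd_stable π g)
  map_one' := by ext; rfl
  map_mul' g h := by
    ext f x
    simp [LinearMap.restrict_apply, LinearMap.funLeft]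

/-- The part of degree `j` of `L_{b_1} ⊗ ⋯ ⊗ L_{b_r}`, where `L_b = ⋀^* S^{(b-1,1)}`, as
a representation of the Young subgroup. The tensor product of the exterior algebras
`⋀^* S^{(b_i-1,1)}` is the exterior algebra of the direct sum `⨁_i S^{(b_i-1,1)}`, via
`x_1 ⊗ ⋯ ⊗ x_r ↦ x_1 ∧ ⋯ ∧ x_r`, so this is `⋀^j (⨁_i S^{(b_i-1,1)})`. -/
def blockExteriorRep (π : Setoid V) (j : ℕ) :
    Representation ℂ (youngSubgroup π) (⋀[ℂ]^j (blockStd π)) where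
  toFun g := exteriorPower.map j (blockStdRep π g)
  map_one' := by
    rw [map_one]
    exact exteriorPower.map_id
  map_mul' g h := by
    rw [map_mul]
    exact exteriorPower.map_comp (n := j) (blockStdRep π h) (blockStdRep π g)

/-- The inclusion `L_{b_1} ⊗ ⋯ ⊗ L_{b_r} → L_{b'_1} ⊗ ⋯ ⊗ L_{b'_s}` in degree `j`, for
a partition `π` that refines `σ`. It multiplies the tensor factors that belong to blocks of `π`
in the same block of `σ`. -/
def blockExteriorMap {π σ : Setoid V} (h : π ≤ σ) (j : ℕ) :
    (⋀[ℂ]^j (blockStd π)) →ₗ[ℂ] (⋀[ℂ]^j (blockStd σ)) :=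
  exteriorPower.map j (Submodule.inclusion (blockStd_mono h))

theorem blockExteriorMap_equivariant {π σ : Setoid V} (h : π ≤ σ) (j : ℕ) (g : youngSubgroup π) :
    blockExteriorMap h j ∘ₗ blockExteriorRep π j g =
      blockExteriorRep σ j ⟨g.1, youngSubgroup_mono h g.2⟩ ∘ₗ blockExteriorMap h j := by
  change exteriorPower.map j _ ∘ₗ exteriorPower.map j _ =
    exteriorPower.map j _ ∘ₗ exteriorPower.map j _
  rw [← exteriorPower.map_comp, ← exteriorPower.map_comp]
  rfl

theorem blockExteriorMap_equivariant_apply {π σ : Setoid V} (h : π ≤ σ) (j : ℕ)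
    (g : youngSubgroup π) (x : ⋀[ℂ]^j (blockStd π)) :
    blockExteriorMap h j (blockExteriorRep π j g x) =
      blockExteriorRep σ j ⟨g.1, youngSubgroup_mono h g.2⟩ (blockExteriorMap h j x) :=
  LinearMap.congr_fun (blockExteriorMap_equivariant h j g) x

/-- The part of degree `j` of `M_π = Ind (L_{b_1} ⊗ ⋯ ⊗ L_{b_r})`, induced from the Young
subgroup of `π` to the symmetric group of `V`. -/
abbrev youngModule (π : Setoid V) (j : ℕ) : Rep.{u} ℂ (Equiv.Perm V) :=
  Rep.of ((blockExteriorRep π j).ind (youngSubgroup π).subtype)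

/-- The map `M_π → M_σ`, for `π` refining `σ`, in degree `j`: it sends `⟦g ⊗ x⟧` to
`⟦g ⊗ ι x⟧`, where `ι` is the inclusion of `L_{b_1} ⊗ ⋯ ⊗ L_{b_r}` into the restriction of
`L_{b'_1} ⊗ ⋯ ⊗ L_{b'_s}`. -/
def youngModuleMap {π σ : Setoid V} (h : π ≤ σ) (j : ℕ) : youngModule π j ⟶ youngModule σ j :=
  Rep.ofHom
    ⟨Coinvariants.lift _ (Coinvariants.mk _ ∘ₗ (blockExteriorMap h j).lTensor _) (by
      intro g
      refine TensorProduct.ext' fun a x => ?_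
      refine Eq.trans ?_ (Coinvariants.mk_self_apply
        (Representation.tprod ((leftRegular ℂ (Equiv.Perm V)).comp (youngSubgroup σ).subtype)
          (blockExteriorRep σ j)) ⟨g.1, youngSubgroup_mono h g.2⟩ (a ⊗ₜ blockExteriorMap h j x))
      change Coinvariants.mk _ (_ ⊗ₜ blockExteriorMap h j (blockExteriorRep π j g x)) =
        Coinvariants.mk _ (_ ⊗ₜ blockExteriorRep σ j _ (blockExteriorMap h j x))
      rw [← blockExteriorMap_equivariant_apply]
      rfl), by
      intro g
      ext a x
      simp⟩

theorem youngModuleMap_mk {π σ : Setoid V} (h : π ≤ σ) (j : ℕ) (g : Equiv.Perm V)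
    (x : ⋀[ℂ]^j (blockStd π)) :
    (youngModuleMap h j).hom (IndV.mk _ _ g x) = IndV.mk _ _ g (blockExteriorMap h j x) := rfl

theorem youngModuleMap_refl (π : Setoid V) (j : ℕ) :
    youngModuleMap (le_refl π) j = 𝟙 (youngModule π j) := by
  apply Rep.hom_ext
  apply Representation.IntertwiningMap.toLinearMap_injective
  refine IndV.hom_ext _ _ fun g => LinearMap.ext fun x => ?_
  refine (youngModuleMap_mk (le_refl π) j g x).trans ?_
  have : blockExteriorMap (le_refl π) j = LinearMap.id := exteriorPower.map_id
  rw [this]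
  rfl

theorem youngModuleMap_trans {π σ τ : Setoid V} (h : π ≤ σ) (h' : σ ≤ τ) (j : ℕ) :
    youngModuleMap (h.trans h') j = youngModuleMap h j ≫ youngModuleMap h' j := by
  apply Rep.hom_ext
  apply Representation.IntertwiningMap.toLinearMap_injective
  refine IndV.hom_ext _ _ fun g => LinearMap.ext fun x => ?_
  refine (youngModuleMap_mk (h.trans h') j g x).trans ?_
  have : blockExteriorMap (h.trans h') j = blockExteriorMap h' j ∘ₗ blockExteriorMap h j :=
    exteriorPower.map_comp (n := j) (Submodule.inclusion (blockStd_mono h))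
      (Submodule.inclusion (blockStd_mono h'))
  rw [this]
  rfl

/-- Graded `ℂ[𝔖_V]`-modules (in nonnegative degrees) with the degree-preserving maps. -/
abbrev GradedPermModule (V : Type u) := Discrete ℕ ⥤ Rep.{u} ℂ (Equiv.Perm V)

/-- The functor `π ↦ M_π` on the partitions of `V`, ordered by refinement. -/
def partitionFunctor (V : Type u) [Fintype V] : Setoid V ⥤ GradedPermModule V where
  obj π := Discrete.functor fun j => youngModule π j
  map f := Discrete.natTrans fun j => youngModuleMap f.le j.as
  map_id π := by
    ext ⟨j⟩ : 2
    exact youngModuleMap_refl π j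
  map_comp f g := by
    ext ⟨j⟩ : 2
    exact youngModuleMap_trans f.le g.le j

/-- The chromatic symmetric functor `F^CS_G` on `2^E`: it sends `T` to `M_T = M_{λ(T)}`, where
`λ(T)` is the partition of `V` into the connected components of `T`. If `e` joins two components of
`T`, with vertex sets `A` and `B`, then `M_T → M_{T + e}` is induced by the inclusion of
`L_A ⊗ L_B` into the restriction of `L_{A ∪ B}`; if `e` completes a cycle in `T`, then
`λ(T) = λ(T + e)` and the map is the identity. -/
def chromaticSymmetricFunctor (G : SimpleGraph V) : Finset G.edgeSet ⥤ GradedPermModule V :=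
  G.componentSetoid_mono.functor ⋙ partitionFunctor V

end ChromaticSymmetric

/-!
Call an edge `e` *spanned below* by an edge set `T` if its ends are joined by a path of edges of
`T` that are smaller than `e`. Such a path and `e` close up to a cycle with largest edge `e`, so `T`
contains a broken circuit if and only if it spans some edge below
(`SimpleGraph.exists_isBrokenCircuit_subset_iff`).

For a set `s` of edges let `nbcOn s` be the ideal of the edge sets that span no edge of `s` below.
It grows smaller from `2^E` to `NBC` as `s` grows from `∅` to `E`. The edges are added to `s` in
decreasing order. If `e` is smaller than all edges in `s`, the edge sets `T` that are lost from
`nbcOn s` to `nbcOn (insert e s)` are those that span `e` below. For such `T`, adding or removing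
`e` changes neither the connected components of the edges that are smaller than some `f ∈ s`
(`SimpleGraph.IsSpannedBelow.of_insert`) nor the connected components of `T`. Hence the lost edge
sets come in pairs `T ⋖ T ∪ {e}` on which the chromatic symmetric functor is an isomorphism.

The cochains of the larger ideal project onto those of the smaller one, and the kernel is the sum
over the lost edge sets. Up to sign this kernel is the mapping cone of an isomorphism between the
summands without `e` and those with `e`, so the inverse isomorphisms contract it
(`ParallelMatching.sum_eq_id`, `ParallelMatching.sum_eq_zero`). As the projection is split in each
degree, it is a homotopy equivalence
(`HomologicalComplex.nonempty_homotopyEquiv_of_contracts_kernel`).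
-/

/-! ### Contracting a degreewise split kernel -/

section HomotopyEquivalence

variable {ι : Type*} {A : Type u} [Category.{v} A] [Preadditive A] {c : ComplexShape ι}

/-- A chain map `ψ : C ⟶ D` with degreewise sections `s` is a homotopy equivalence as soon as
the kernel of `ψ` is contracted by a family `h` of maps with values in that kernel: with
`N = 1 - (d h + h d)`, the homotopy inverse is `s ≫ N`. -/
theorem HomologicalComplex.nonempty_homotopyEquiv_of_contracts_kernel
    {C D : HomologicalComplex A c} (ψ : C ⟶ D) (s : ∀ n, D.X n ⟶ C.X n)
    (hs : ∀ n, s n ≫ ψ.f n = 𝟙 _) (h : ∀ i j, c.Rel j i → (C.X i ⟶ C.X j))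
    (hψ : ∀ i j r, h i j r ≫ ψ.f j = 0)
    (hN : ∀ n, (𝟙 _ - ψ.f n ≫ s n) ≫ (𝟙 _ - (Homotopy.nullHomotopicMap' h).f n) = 0) :
    Nonempty (HomotopyEquiv C D) := by
  set N : C ⟶ C := 𝟙 C - Homotopy.nullHomotopicMap' h with hNdef
  have hNf : ∀ n, ψ.f n ≫ s n ≫ N.f n = N.f n := fun n => by
    have := hN n
    rw [Preadditive.sub_comp, Category.id_comp, sub_eq_zero, Category.assoc] at this
    exact this.symm
  have hNψ : N ≫ ψ = ψ := by
    have h0 : (fun i j r => h i j r ≫ ψ.f j) = fun _ _ _ => 0 := by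
      funext i j r
      exact hψ i j r
    rw [hNdef, Preadditive.sub_comp, Category.id_comp, Homotopy.nullHomotopicMap'_comp, h0,
      sub_eq_self]
    ext n
    simp only [Homotopy.nullHomotopicMap', dite_eq_ite, ite_self]
    change dNext n 0 + prevD n 0 = 0
    rw [map_zero, map_zero, add_zero]
  have hepi : ∀ n, Epi (ψ.f n) := fun n => (SplitEpi.mk (s n) (hs n)).epi
  let inv : D ⟶ C :=
    { f := fun n => s n ≫ N.f n
      comm' := fun i j _ => by
        rw [← cancel_epi (ψ.f i), Category.assoc, reassoc_of% (hNf i), ψ.comm_assoc, hNf, N.comm] }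
  have h1 : ψ ≫ inv = N := by
    ext n
    exact hNf n
  have h2 : inv ≫ ψ = 𝟙 D := by
    ext n
    have := congr_arg (fun f => f.f n) hNψ
    simp only [HomologicalComplex.comp_f] at this
    simp [inv, this, hs]
  have h3 : 𝟙 C - ψ ≫ inv = Homotopy.nullHomotopicMap' h := by rw [h1, hNdef, sub_sub_cancel]
  exact ⟨⟨ψ, inv, (Homotopy.equivSubZero.symm
    ((Homotopy.ofEq h3).trans (Homotopy.nullHomotopy' h))).symm, Homotopy.ofEq h2⟩⟩

/-- The contraction criterion for cochain complexes given by sequences of objects and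
differentials. Only the components `h (n + 1) n` of the family `h` matter. -/
theorem CochainComplex.nonempty_homotopyEquiv_of_of_contracts_kernel
    (X Y : ℕ → A) (dX : ∀ n, X n ⟶ X (n + 1)) (dY : ∀ n, Y n ⟶ Y (n + 1))
    (hX : ∀ n, dX n ≫ dX (n + 1) = 0) (hY : ∀ n, dY n ≫ dY (n + 1) = 0)
    (ψ : ∀ n, X n ⟶ Y n) (hψ : ∀ n, ψ n ≫ dY n = dX n ≫ ψ (n + 1))
    (s : ∀ n, Y n ⟶ X n) (hs : ∀ n, s n ≫ ψ n = 𝟙 _) (h : ∀ i j, X i ⟶ X j)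
    (hhψ : ∀ i j, h i j ≫ ψ j = 0)
    (h0 : (𝟙 _ - ψ 0 ≫ s 0) ≫ (𝟙 _ - dX 0 ≫ h 1 0) = 0)
    (hn : ∀ n, (𝟙 _ - ψ (n + 1) ≫ s (n + 1)) ≫
      (𝟙 _ - (dX (n + 1) ≫ h (n + 2) (n + 1) + h (n + 1) n ≫ dX n)) = 0) :
    Nonempty (HomotopyEquiv (CochainComplex.of X dX hX) (CochainComplex.of Y dY hY)) := by
  have hdX : ∀ n, (CochainComplex.of X dX hX).d n (n + 1) = dX n := CochainComplex.of_d X dX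
  have hdY : ∀ n, (CochainComplex.of Y dY hY).d n (n + 1) = dY n := CochainComplex.of_d Y dY
  let Ψ : CochainComplex.of X dX hX ⟶ CochainComplex.of Y dY hY :=
    CochainComplex.ofHom ψ fun n =>
      ((congrArg (ψ n ≫ ·) (hdY n)).trans (hψ n)).trans
        (congrArg (· ≫ ψ (n + 1)) (hdX n)).symm
  refine HomologicalComplex.nonempty_homotopyEquiv_of_contracts_kernel Ψ s hs
    (fun i j _ => h i j) (fun i j _ => hhψ i j) fun n => ?_
  rcases n with _ | n
  · rw [Homotopy.nullHomotopicMap'_f_of_not_rel_right (k₀ := 1) (by simp) (by simp), hdX]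
    exact h0
  · rw [Homotopy.nullHomotopicMap'_f (k₂ := n) (k₀ := n + 1 + 1) (by simp) (by simp), hdX, hdX]
    exact hn n

end HomotopyEquivalence

/-! ### Restriction of a functor along the inclusion of a lower set -/

noncomputable section Restriction

attribute [local instance] CategoryTheory.Abelian.hasFiniteBiproducts

theorem OrderEmbedding.covBy_iff_of_isLowerSet_range {P Q : Type*} [PartialOrder P]
    [PartialOrder Q] (φ : Q ↪o P) (hφ : IsLowerSet (Set.range φ)) {x y : Q} :
    φ x ⋖ φ y ↔ x ⋖ y := by
  refine ⟨fun h => h.of_image φ, fun h => ⟨φ.strictMono h.lt, fun z hxz hzy => ?_⟩⟩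
  obtain ⟨z, rfl⟩ := hφ hzy.le ⟨y, rfl⟩
  exact h.2 (φ.lt_iff_lt.1 hxz) (φ.lt_iff_lt.1 hzy)

theorem sum_rankLevel_eq_sum {P : Type w} [PartialOrder P] [GradeOrder ℕ P] [Fintype P]
    {M : Type*} [AddCommMonoid M] (k : ℕ) [Fintype (RankLevel P k)] (f : P → M)
    (hf : ∀ y, grade ℕ y ≠ k → f y = 0) : ∑ y : RankLevel P k, f y.1 = ∑ y, f y := by
  classical
  rw [← Finset.sum_subtype (Finset.univ.filter fun y : P => grade ℕ y = k) (by simp) f]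
  exact Finset.sum_filter_of_ne fun y _ hy => by_contra fun h => hy (hf y h)

theorem grade_eq_of_covBy {P : Type w} [PartialOrder P] [GradeOrder ℕ P] {x y : P} (h : x ⋖ y) :
    grade ℕ y = grade ℕ x + 1 :=
  ((Nat.covBy_iff_add_one_eq).1 (h.grade ℕ)).symm

theorem posetEntry_of_not_covBy {P : Type w} [PartialOrder P] {A : Type u} [Category.{v} A]
    [Abelian A] (F : P ⥤ A) (c : BalancedColoring P) {x y : P} (h : ¬ x ⋖ y) :
    posetEntry F c x y = 0 := by
  rw [posetEntry, dif_neg h]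

variable {P Q : Type w} [PartialOrder P] [PartialOrder Q] {A : Type u} [Category.{v} A]

/-- A functor `F'` on `Q` with a sign rule `c'` that is the restriction of `(F, c)` along an
embedding `φ : Q ↪o P` as a lower set which preserves ranks. The isomorphism between `F'` and
`φ ⋙ F` is given by its components. -/
structure LowerRestriction [GradeOrder ℕ P] [GradeOrder ℕ Q] (F : P ⥤ A) (c : BalancedColoring P)
    (F' : Q ⥤ A) (c' : BalancedColoring Q) where
  φ : Q ↪o P
  isLowerSet_range : IsLowerSet (Set.range φ)
  grade_eq : ∀ q, grade ℕ (φ q) = grade ℕ q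
  sign_eq : ∀ x y h h', c'.sign x y h = c.sign (φ x) (φ y) h'
  iso : ∀ q, F.obj (φ q) ≅ F'.obj q
  naturality : ∀ x y (h : x ≤ y), F.map (homOfLE (φ.monotone h)) ≫ (iso y).hom =
    (iso x).hom ≫ F'.map (homOfLE h)

variable [GradeOrder ℕ P] [GradeOrder ℕ Q] {F : P ⥤ A} {c : BalancedColoring P} {F' : Q ⥤ A}
  {c' : BalancedColoring Q}

/-- The inclusion of the elements of rank `k`. -/
abbrev LowerRestriction.level (R : LowerRestriction F c F' c') (k : ℕ)
    (q : RankLevel Q k) : RankLevel P k :=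
  ⟨R.φ q.1, (R.grade_eq q.1).trans q.2⟩

theorem LowerRestriction.exists_level_eq (R : LowerRestriction F c F' c') {k : ℕ}
    (x : RankLevel P k) (hx : x.1 ∈ Set.range R.φ) : ∃ q, R.level k q = x := by
  obtain ⟨q, hq⟩ := hx
  exact ⟨⟨q, by rw [← R.grade_eq, hq, x.2]⟩, Subtype.ext hq⟩

variable [Abelian A]

theorem LowerRestriction.posetEntry_comp (R : LowerRestriction F c F' c') (x y : Q) :
    posetEntry F c (R.φ x) (R.φ y) ≫ (R.iso y).hom = (R.iso x).hom ≫ posetEntry F' c' x y := by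
  unfold posetEntry
  by_cases h : x ⋖ y
  · have h' := (R.φ.covBy_iff_of_isLowerSet_range R.isLowerSet_range).2 h
    rw [dif_pos h, dif_pos h', R.sign_eq x y h h', Preadditive.zsmul_comp, Preadditive.comp_zsmul,
      R.naturality x y h.le]
  · rw [dif_neg h, dif_neg (mt (R.φ.covBy_iff_of_isLowerSet_range R.isLowerSet_range).1 h),
      zero_comp, comp_zero]

variable [Finite P] [Finite Q]

theorem ι_posetDifferential_π (F : P ⥤ A) (c : BalancedColoring P) (k : ℕ) (x : RankLevel P k)
    (y : RankLevel P (k + 1)) :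
    biproduct.ι (fun x : RankLevel P k => F.obj x.1) x ≫ posetDifferential F c k ≫
      biproduct.π (fun x : RankLevel P (k + 1) => F.obj x.1) y = posetEntry F c x.1 y.1 := by
  simp [posetDifferential]

/-- The map `⨁_{rk x = i} F x ⟶ ⨁_{rk y = j} F y` with matrix `θ`. -/
def cochainMatrix (F : P ⥤ A) (θ : ∀ x y : P, F.obj x ⟶ F.obj y) (i j : ℕ) :
    posetCochains F i ⟶ posetCochains F j :=
  biproduct.desc fun x : RankLevel P i => biproduct.lift fun y : RankLevel P j => θ x.1 y.1

theorem ι_cochainMatrix_comp_cochainMatrix_π {P : Type w} [PartialOrder P] [GradeOrder ℕ P]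
    [Fintype P] (F : P ⥤ A)
    (θ η : ∀ x y : P, F.obj x ⟶ F.obj y) (i j k : ℕ) (x : RankLevel P i) (z : RankLevel P k)
    (h0 : ∀ y, grade ℕ y ≠ j → θ x.1 y ≫ η y z.1 = 0) :
    biproduct.ι (fun x : RankLevel P i => F.obj x.1) x ≫
      (cochainMatrix F θ i j ≫ cochainMatrix F η j k) ≫
        biproduct.π (fun x : RankLevel P k => F.obj x.1) z = ∑ y, θ x.1 y ≫ η y z.1 := by
  have : Fintype (RankLevel P j) := Fintype.ofFinite _
  rw [← sum_rankLevel_eq_sum j _ h0]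
  simp only [cochainMatrix, Category.assoc, biproduct.ι_desc_assoc]
  rw [← Category.assoc, biproduct_lift_desc_eq_sum, Preadditive.sum_comp]
  simp

namespace LowerRestriction

variable (R : LowerRestriction F c F' c')

/-- The projection `⨁_{rk x = k} F x ⟶ ⨁_{rk q = k} F' q` that forgets the summands outside of
the range of `φ`. -/
def proj (k : ℕ) : posetCochains F k ⟶ posetCochains F' k :=
  biproduct.lift fun q : RankLevel Q k =>
    biproduct.π (fun x : RankLevel P k => F.obj x.1) (R.level k q) ≫ (R.iso q.1).hom

/-- The inclusion `⨁_{rk q = k} F' q ⟶ ⨁_{rk x = k} F x` of the summands in the range of `φ`. -/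
def incl (k : ℕ) : posetCochains F' k ⟶ posetCochains F k :=
  biproduct.desc fun q : RankLevel Q k =>
    (R.iso q.1).inv ≫ biproduct.ι (fun x : RankLevel P k => F.obj x.1) (R.level k q)

theorem ι_proj (k : ℕ) (q : RankLevel Q k) :
    biproduct.ι (fun x : RankLevel P k => F.obj x.1) (R.level k q) ≫ R.proj k =
    (R.iso q.1).hom ≫ biproduct.ι (fun q : RankLevel Q k => F'.obj q.1) q := by
  apply biproduct.hom_ext
  intro r
  simp only [proj, Category.assoc, biproduct.lift_π]
  by_cases h : q = r
  · subst h
    rw [biproduct.ι_π_self_assoc, biproduct.ι_π_self, Category.comp_id]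
  · rw [biproduct.ι_π_ne _ h, biproduct.ι_π_ne_assoc, zero_comp, comp_zero]
    exact fun e => h (Subtype.ext (R.φ.injective (congrArg Subtype.val e)))

theorem ι_proj_of_notMem (k : ℕ) (x : RankLevel P k) (hx : x.1 ∉ Set.range R.φ) :
    biproduct.ι (fun x : RankLevel P k => F.obj x.1) x ≫ R.proj k = 0 := by
  apply biproduct.hom_ext
  intro r
  simp only [proj, Category.assoc, biproduct.lift_π, zero_comp]
  rw [biproduct.ι_π_ne_assoc, zero_comp]
  rintro rfl
  exact hx ⟨r.1, rfl⟩

theorem incl_proj (k : ℕ) : R.incl k ≫ R.proj k = 𝟙 _ := by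
  apply biproduct.hom_ext'
  intro q
  rw [incl, biproduct.ι_desc_assoc, Category.assoc, ι_proj, Iso.inv_hom_id_assoc, Category.comp_id]

theorem proj_comm (k : ℕ) :
    R.proj k ≫ posetDifferential F' c' k = posetDifferential F c k ≫ R.proj (k + 1) := by
  apply biproduct.hom_ext'
  intro x
  apply biproduct.hom_ext
  intro r
  have hr : R.proj (k + 1) ≫ biproduct.π (fun q : RankLevel Q (k + 1) => F'.obj q.1) r =
      biproduct.π (fun x : RankLevel P (k + 1) => F.obj x.1) (R.level (k + 1) r) ≫
        (R.iso r.1).hom := biproduct.lift_π _ _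
  simp only [Category.assoc]
  have hd := ι_posetDifferential_π F c k x (R.level (k + 1) r)
  rw [hr, reassoc_of% hd]
  by_cases hx : x.1 ∈ Set.range R.φ
  · obtain ⟨q, rfl⟩ := R.exists_level_eq x hx
    have hq := R.ι_proj k q
    rw [reassoc_of% hq, ι_posetDifferential_π, R.posetEntry_comp]
  · have hq := R.ι_proj_of_notMem k x hx
    rw [reassoc_of% hq, zero_comp, posetEntry_of_not_covBy, zero_comp]
    exact fun h => hx (R.isLowerSet_range h.le ⟨r.1, rfl⟩)

/-- If the matrix `θ`, supported on pairs `y ⋖ x` with `y` outside of the range of `φ`, satisfies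
`d θ + θ d = 1` on the summands outside of this range, then these summands do not contribute to
the cohomology. -/
theorem nonempty_iso_of_contraction {P : Type w} [PartialOrder P] [GradeOrder ℕ P]
    [Fintype P] [IsThinPoset P] [IsThinPoset Q] {F : P ⥤ A} {c : BalancedColoring P}
    (R : LowerRestriction F c F' c')
    (θ : ∀ x y : P, F.obj x ⟶ F.obj y) (hθ : ∀ x y, ¬ y ⋖ x → θ x y = 0)
    (hθQ : ∀ x q, θ x (R.φ q) = 0)
    (hdiag : ∀ x, x ∉ Set.range R.φ →
      ∑ y, posetEntry F c x y ≫ θ y x + ∑ y, θ x y ≫ posetEntry F c y x = 𝟙 _)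
    (hoff : ∀ x z, x ∉ Set.range R.φ → z ≠ x →
      ∑ y, posetEntry F c x y ≫ θ y z + ∑ y, θ x y ≫ posetEntry F c y z = 0) (i : ℕ) :
    Nonempty (posetCohomology F c i ≅ posetCohomology F' c' i) := by
  -- In each degree the assertion about `N = 1 - M`, `M = d θ + θ d`, is checked on the summands.
  have key : ∀ (n : ℕ) (M : posetCochains F n ⟶ posetCochains F n),
      (∀ x z : RankLevel P n, biproduct.ι (fun x : RankLevel P n => F.obj x.1) x ≫ M ≫
          biproduct.π (fun x : RankLevel P n => F.obj x.1) z =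
        ∑ y, posetEntry F c x.1 y ≫ θ y z.1 + ∑ y, θ x.1 y ≫ posetEntry F c y z.1) →
      (𝟙 _ - R.proj n ≫ R.incl n) ≫ (𝟙 _ - M) = 0 := by
    intro n M hM
    apply biproduct.hom_ext'
    intro x
    have e : biproduct.ι (fun x : RankLevel P n => F.obj x.1) x ≫ (𝟙 _ - R.proj n ≫ R.incl n) =
        biproduct.ι (fun x : RankLevel P n => F.obj x.1) x -
          (biproduct.ι (fun x : RankLevel P n => F.obj x.1) x ≫ R.proj n) ≫ R.incl n := by
      rw [Preadditive.comp_sub, Category.comp_id, Category.assoc]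
    rw [← Category.assoc, e, comp_zero]
    by_cases hx : x.1 ∈ Set.range R.φ
    · obtain ⟨q, rfl⟩ := R.exists_level_eq x hx
      rw [R.ι_proj n q, Category.assoc, incl, biproduct.ι_desc, Iso.hom_inv_id_assoc, sub_self, zero_comp]
    · rw [R.ι_proj_of_notMem n x hx, zero_comp, sub_zero, Preadditive.comp_sub, sub_eq_zero, Category.comp_id]
      apply biproduct.hom_ext
      intro z
      rw [Category.assoc, hM]
      by_cases hxz : z = x
      · subst hxz
        rw [hdiag _ hx, biproduct.ι_π_self]
      · rw [hoff _ _ hx fun e => hxz (Subtype.ext e), biproduct.ι_π_ne _ (Ne.symm hxz)]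
  have hdθ : ∀ (n : ℕ) (x z : RankLevel P n), _ := fun n x z =>
    ι_cochainMatrix_comp_cochainMatrix_π F (posetEntry F c) θ n (n + 1) n x z fun y hy => by
      rw [posetEntry_of_not_covBy, zero_comp]
      intro hxy
      exact hy (by rw [grade_eq_of_covBy hxy, x.2])
  refine (CochainComplex.nonempty_homotopyEquiv_of_of_contracts_kernel (posetCochains F)
    (posetCochains F') (posetDifferential F c) (posetDifferential F' c')
    (posetDifferential_comp F c) (posetDifferential_comp F' c') R.proj R.proj_comm R.incl
    R.incl_proj (cochainMatrix F θ) ?_ ?_ ?_).map fun e => e.toHomologyIso i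
  · intro i j
    apply biproduct.hom_ext'
    intro x
    apply biproduct.hom_ext
    intro q
    simp [cochainMatrix, proj, hθQ]
  · refine key 0 _ fun x z => ?_
    rw [Finset.sum_eq_zero (f := fun y => θ x.1 y ≫ posetEntry F c y z.1), add_zero, ← hdθ 0]
    · rfl
    · intro y _
      rw [hθ, zero_comp]
      intro hxy
      have := grade_eq_of_covBy hxy
      rw [x.2] at this
      omega
  · intro n
    refine key (n + 1) _ fun x z => ?_
    have hθd := ι_cochainMatrix_comp_cochainMatrix_π F θ (posetEntry F c) (n + 1) n (n + 1)
      x z fun y hy => by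
        rw [hθ, zero_comp]
        intro hxy
        have := grade_eq_of_covBy hxy
        rw [x.2] at this
        omega
    rw [← hdθ, ← hθd, ← Preadditive.comp_add, ← Preadditive.add_comp]
    rfl

end LowerRestriction

end Restriction

/-! ### Parallel matchings -/

noncomputable section ParallelMatchings

section Relations

variable {P : Type w} [PartialOrder P] {A : Type u} [Category.{v} A]

/-- A perfect matching `M` of a set `D` of poset elements along cover relations `w ⋖ x`
(written `M w x`) which `F` sends to isomorphisms. It is *parallel*: if `w ⋖ x` is in `M` and
`w ⋖ z` is another cover, then `z ⋖ y` is in `M` for some `y` that covers `x` (`lift`), and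
conversely (`descend`). So the cochains on `D` form, up to sign, the mapping cone of an isomorphism
from the lower ends to the upper ends. -/
structure ParallelMatching (F : P ⥤ A) (D : Set P) (M : P → P → Prop) : Prop where
  covBy {w x : P} : M w x → w ⋖ x
  isIso {w x : P} (h : M w x) : IsIso (F.map (homOfLE (covBy h).le))
  mem_lower {w x : P} : M w x → w ∈ D
  exists_of_mem {x : P} : x ∈ D → (∃ w, M w x) ∨ ∃ y, M x y
  not_both {w x y : P} : M w x → ¬ M x y
  eq_lower {w w' x : P} : M w x → M w' x → w' = w
  eq_upper {w x x' : P} : M w x → M w x' → x' = x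
  lift {w x z : P} : M w x → w ⋖ z → z ≠ x → ∃ y, M z y ∧ x ⋖ y
  descend {x y z : P} : M z y → x ⋖ y → x ≠ z → x ∈ D → ∃ w, M w x ∧ w ⋖ z

end Relations

variable {P : Type w} [PartialOrder P] {A : Type u} [Category.{v} A] [Abelian A]
  {F : P ⥤ A} {D : Set P} {M : P → P → Prop}

theorem posetEntry_comp_eq_neg (F : P ⥤ A) (c : BalancedColoring P) {w x y z : P} (hwx : w ⋖ x)
    (hxy : x ⋖ y) (hwz : w ⋖ z) (hzy : z ⋖ y) (hxz : x ≠ z) :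
    posetEntry F c w x ≫ posetEntry F c x y = -(posetEntry F c w z ≫ posetEntry F c z y) := by
  have hc := c.balanced w x z y hwx hxy hwz hzy hxz
  simp only [posetEntry, hwx, hxy, hwz, hzy, dif_pos, Preadditive.zsmul_comp,
    Preadditive.comp_zsmul, smul_smul, ← F.map_comp, homOfLE_comp]
  rw [← neg_smul]
  congr 1
  rcases Int.units_eq_one_or (c.sign w x hwx) with h1 | h1 <;>
  rcases Int.units_eq_one_or (c.sign x y hxy) with h2 | h2 <;>
  rcases Int.units_eq_one_or (c.sign w z hwz) with h3 | h3 <;>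
  rcases Int.units_eq_one_or (c.sign z y hzy) with h4 | h4 <;>
  rw [h1, h2, h3, h4] at hc ⊢ <;> revert hc <;> decide

open scoped Classical in
/-- The matrix of inverses of the entries of the differential along the edges of a matching, with
zero entries elsewhere. -/
def ParallelMatching.inverse (hM : ParallelMatching F D M) (c : BalancedColoring P) (x w : P) :
    F.obj x ⟶ F.obj w :=
  if h : M w x then
    ((c.sign w x (hM.covBy h) : ℤˣ) : ℤ) • (hM.isIso h).out.choose
  else 0

namespace ParallelMatching

variable (hM : ParallelMatching F D M) (c : BalancedColoring P)

theorem inverse_of_not {x w : P} (h : ¬ M w x) : hM.inverse c x w = 0 := by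
  rw [inverse, dif_neg h]

theorem posetEntry_inverse {w x : P} (h : M w x) :
    posetEntry F c w x ≫ hM.inverse c x w = 𝟙 _ := by
  rw [inverse, dif_pos h, posetEntry, dif_pos (hM.covBy h), Preadditive.zsmul_comp,
    Preadditive.comp_zsmul, smul_smul, (hM.isIso h).out.choose_spec.1]
  rcases Int.units_eq_one_or (c.sign w x (hM.covBy h)) with h1 | h1 <;> simp [h1]

theorem inverse_posetEntry {w x : P} (h : M w x) :
    hM.inverse c x w ≫ posetEntry F c w x = 𝟙 _ := by
  rw [inverse, dif_pos h, posetEntry, dif_pos (hM.covBy h), Preadditive.zsmul_comp,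
    Preadditive.comp_zsmul, smul_smul, (hM.isIso h).out.choose_spec.2]
  rcases Int.units_eq_one_or (c.sign w x (hM.covBy h)) with h1 | h1 <;> simp [h1]

theorem posetEntry_inverse_add_eq_zero {w x y z : P} (hwx : M w x) (hxy : x ⋖ y) (hwz : w ⋖ z)
    (hzy : M z y) (hxz : x ≠ z) :
    posetEntry F c x y ≫ hM.inverse c y z + hM.inverse c x w ≫ posetEntry F c w z = 0 := by
  have h := posetEntry_comp_eq_neg F c (hM.covBy hwx) hxy hwz (hM.covBy hzy) hxz
  have h1 := hM.inverse_posetEntry c hwx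
  have h2 := hM.posetEntry_inverse c hzy
  have h3 := congrArg (fun f => hM.inverse c x w ≫ f ≫ hM.inverse c y z) h
  simp only [Category.assoc, Preadditive.neg_comp, Preadditive.comp_neg] at h3
  rw [reassoc_of% h1, h2, Category.comp_id] at h3
  rw [h3, neg_add_cancel]

section Sums

variable [Fintype P]

theorem sum_eq_id {x : P} (hx : x ∈ D) :
    ∑ y, posetEntry F c x y ≫ hM.inverse c y x + ∑ y, hM.inverse c x y ≫ posetEntry F c y x =
      𝟙 _ := by
  rcases hM.exists_of_mem hx with ⟨w, hw⟩ | ⟨y, hy⟩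
  · rw [Finset.sum_eq_zero, zero_add, Finset.sum_eq_single w, hM.inverse_posetEntry c hw]
    · intro w' _ hne
      rw [hM.inverse_of_not c fun h => hne (hM.eq_lower hw h), zero_comp]
    · simp
    · intro y _
      rw [hM.inverse_of_not c (hM.not_both hw), comp_zero]
  · rw [Finset.sum_eq_single y, hM.posetEntry_inverse c hy, Finset.sum_eq_zero, add_zero]
    · intro w _
      rw [hM.inverse_of_not c fun h => hM.not_both h hy, zero_comp]
    · intro y' _ hne
      rw [hM.inverse_of_not c fun h => hne (hM.eq_upper hy h), comp_zero]
    · simp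

theorem sum_eq_zero {x z : P} (hx : x ∈ D) (hzx : z ≠ x) :
    ∑ y, posetEntry F c x y ≫ hM.inverse c y z + ∑ y, hM.inverse c x y ≫ posetEntry F c y z =
      0 := by
  by_cases H : ∃ w, M w x ∧ w ⋖ z
  · obtain ⟨w, hwx, hwz⟩ := H
    obtain ⟨y, hzy, hxy⟩ := hM.lift hwx hwz hzx
    rw [Finset.sum_eq_single y, Finset.sum_eq_single w,
      hM.posetEntry_inverse_add_eq_zero c hwx hxy hwz hzy hzx.symm]
    · intro w' _ hne
      rw [hM.inverse_of_not c fun h => hne (hM.eq_lower hwx h), zero_comp]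
    · simp
    · intro y' _ hne
      rw [hM.inverse_of_not c fun h => hne (hM.eq_upper hzy h), comp_zero]
    · simp
  · rw [Finset.sum_eq_zero, Finset.sum_eq_zero, add_zero]
    · intro w _
      by_cases hwx : M w x
      · rw [posetEntry_of_not_covBy _ _ fun hwz => H ⟨w, hwx, hwz⟩, comp_zero]
      · rw [hM.inverse_of_not c hwx, zero_comp]
    · intro y _
      by_cases hzy : M z y
      · rw [posetEntry_of_not_covBy _ _ fun hxy => H (hM.descend hzy hxy hzx.symm hx), zero_comp]
      · rw [hM.inverse_of_not c hzy, comp_zero]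

end Sums

end ParallelMatching

/-- Removing a parallel matched set of elements above a lower set does not change the cohomology:
the inverse matrix of the matching contracts the complex of the removed summands. -/
theorem LowerRestriction.nonempty_iso_of_parallelMatching {P Q : Type w} [PartialOrder P]
    [GradeOrder ℕ P] [Finite P] [PartialOrder Q] [GradeOrder ℕ Q] [Finite Q] [IsThinPoset P]
    [IsThinPoset Q] {F : P ⥤ A} {c : BalancedColoring P} {F' : Q ⥤ A} {c' : BalancedColoring Q}
    (R : LowerRestriction F c F' c') {M : P → P → Prop}
    (hM : ParallelMatching F (Set.range R.φ)ᶜ M) (i : ℕ) :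
    Nonempty (posetCohomology F c i ≅ posetCohomology F' c' i) := by
  have : Fintype P := Fintype.ofFinite P
  refine R.nonempty_iso_of_contraction (hM.inverse c)
    (fun x y h => hM.inverse_of_not c fun h' => h (hM.covBy h'))
    (fun x q => hM.inverse_of_not c fun h => hM.mem_lower h ⟨q, rfl⟩)
    (fun x hx => hM.sum_eq_id c hx) (fun x z hx hzx => hM.sum_eq_zero c hx hzx) i

end ParallelMatchings

/-! ### Restriction to smaller lower sets -/

section LowerSets

theorem LowerSet.covBy_coe_iff {P : Type*} [PartialOrder P] (I : LowerSet P) {x y : I} :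
    x.1 ⋖ y.1 ↔ x ⋖ y :=
  ⟨fun h => h.of_image (OrderEmbedding.subtype _), I.covBy_coe⟩

variable {P : Type w} [PartialOrder P] [GradeOrder ℕ P] {A : Type u} [Category.{v} A]

/-- The restriction of a functor to a lower set, further restricted to a smaller lower set. -/
def LowerRestriction.ofLE (F : P ⥤ A) (c : BalancedColoring P) {I J : LowerSet P} (h : J ≤ I) :
    LowerRestriction (restrictToLowerSet F I) (c.restrict I) (restrictToLowerSet F J)
      (c.restrict J) where
  φ := Subtype.orderEmbedding h
  isLowerSet_range := by
    rintro x y hyx ⟨q, rfl⟩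
    exact ⟨⟨y.1, J.lower hyx q.2⟩, rfl⟩
  grade_eq _ := rfl
  sign_eq _ _ _ _ := rfl
  iso _ := Iso.refl _
  naturality _ _ _ := (Category.comp_id _).trans (Category.id_comp _).symm

theorem LowerRestriction.mem_range_ofLE_iff (F : P ⥤ A) (c : BalancedColoring P)
    {I J : LowerSet P} (h : J ≤ I) (x : I) :
    x ∈ Set.range (LowerRestriction.ofLE F c h).φ ↔ x.1 ∈ J := by
  constructor
  · rintro ⟨q, rfl⟩
    exact q.2
  · intro hx
    exact ⟨⟨x.1, hx⟩, rfl⟩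

/-- The restriction of a functor to a lower set. -/
def LowerRestriction.ofLowerSet (F : P ⥤ A) (c : BalancedColoring P) (I : LowerSet P) :
    LowerRestriction F c (restrictToLowerSet F I) (c.restrict I) where
  φ := OrderEmbedding.subtype _
  isLowerSet_range := by
    rintro x y hyx ⟨q, rfl⟩
    exact ⟨⟨y, I.lower hyx q.2⟩, rfl⟩
  grade_eq _ := rfl
  sign_eq _ _ _ _ := rfl
  iso _ := Iso.refl _
  naturality _ _ _ := (Category.comp_id _).trans (Category.id_comp _).symm

theorem nonempty_restrictToLowerSet_iso_of_forall_mem [Finite P] [IsThinPoset P] [Abelian A]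
    (F : P ⥤ A) (c : BalancedColoring P) (I : LowerSet P) (hI : ∀ x, x ∈ I) (i : ℕ) :
    Nonempty (posetCohomology F c i ≅ posetCohomology (restrictToLowerSet F I) (c.restrict I) i) :=
  -- No element is removed, so the empty matching applies.
  have hx : ∀ x, x ∈ Set.range (LowerRestriction.ofLowerSet F c I).φ := fun x => ⟨⟨x, hI x⟩, rfl⟩
  (LowerRestriction.ofLowerSet F c I).nonempty_iso_of_parallelMatching (M := fun _ _ => False)
    { covBy := False.elim
      isIso := fun h => h.elim
      mem_lower := False.elim
      exists_of_mem := fun h => absurd (hx _) h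
      not_both := False.elim
      eq_lower := False.elim
      eq_upper := False.elim
      lift := False.elim
      descend := False.elim } i

end LowerSets

/-! ### Toggling an element in the Boolean lattice -/

/-- Let `J ≤ I` be lower sets of `2^α` such that `I \ J` is closed under adding and removing
a fixed element `a`, and let `F` send these toggles to isomorphisms. The pairs `T ⋖ T ∪ {a}` form
a parallel matching of `I \ J`. -/
theorem Finset.nonempty_restrictToLowerSet_iso_of_toggle {α : Type w} [Finite α] [DecidableEq α]
    {A : Type u} [Category.{v} A] [Abelian A] (F : Finset α ⥤ A) (c : BalancedColoring (Finset α))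
    {I J : LowerSet (Finset α)} (hJI : J ≤ I) (a : α)
    (hinsert : ∀ T ∈ I, T ∉ J → insert a T ∈ I) (herase : ∀ T ∈ I, T ∉ J → T.erase a ∉ J)
    (hiso : ∀ T ∈ I, T ∉ J → IsIso (F.map (homOfLE (Finset.subset_insert a T)))) (i : ℕ) :
    Nonempty (posetCohomology (restrictToLowerSet F I) (c.restrict I) i ≅
      posetCohomology (restrictToLowerSet F J) (c.restrict J) i) := by
  have hmem : ∀ x : I, x ∈ (Set.range (LowerRestriction.ofLE F c hJI).φ)ᶜ ↔ x.1 ∉ J :=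
    fun x => not_congr (LowerRestriction.mem_range_ofLE_iff F c hJI x)
  refine (LowerRestriction.ofLE F c hJI).nonempty_iso_of_parallelMatching
    (M := fun w x => w.1 ∉ J ∧ a ∉ w.1 ∧ x.1 = insert a w.1) ?_ i
  refine
    { covBy := ?_, isIso := ?_, mem_lower := ?_, exists_of_mem := ?_, not_both := ?_,
      eq_lower := ?_, eq_upper := ?_, lift := ?_, descend := ?_ }
  · rintro w x ⟨-, ha, hx⟩
    exact I.covBy_coe_iff.1 (Finset.covBy_iff_exists_insert.2 ⟨a, ha, hx.symm⟩)
  · rintro ⟨w, hw⟩ ⟨x, hx'⟩ ⟨hJ, ha, hx⟩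
    obtain rfl : x = insert a w := hx
    exact hiso w hw hJ
  · rintro w x ⟨hJ, -, -⟩
    exact (hmem w).2 hJ
  · intro x hx
    rw [hmem] at hx
    by_cases ha : a ∈ x.1
    · exact Or.inl ⟨⟨x.1.erase a, I.lower (Finset.erase_subset a x.1) x.2⟩, herase x.1 x.2 hx,
        Finset.notMem_erase a x.1, (Finset.insert_erase ha).symm⟩
    · exact Or.inr ⟨⟨insert a x.1, hinsert x.1 x.2 hx⟩, hx, ha, rfl⟩
  · rintro w x y ⟨-, -, hx⟩ ⟨-, ha, -⟩
    exact ha (hx ▸ Finset.mem_insert_self a w.1)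
  · rintro w w' x ⟨-, ha, hx⟩ ⟨-, ha', hx'⟩
    refine Subtype.ext ?_
    rw [← Finset.erase_insert ha, ← Finset.erase_insert ha', ← hx, ← hx']
  · rintro w x x' ⟨-, -, hx⟩ ⟨-, -, hx'⟩
    exact Subtype.ext (hx'.trans hx.symm)
  · rintro w x z ⟨hJ, ha, hx⟩ hwz hzx
    obtain ⟨b, hb, hz⟩ := Finset.covBy_iff_exists_insert.1 (I.covBy_coe hwz)
    have hab : a ≠ b := by
      rintro rfl
      exact hzx (Subtype.ext (hz.symm.trans hx.symm))
    have hzJ : z.1 ∉ J := fun h => hJ (J.lower hwz.le h)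
    refine ⟨⟨insert a z.1, hinsert z.1 z.2 hzJ⟩, ⟨hzJ, ?_, rfl⟩, I.covBy_coe_iff.1
      (Finset.covBy_iff_exists_insert.2 ⟨b, ?_, ?_⟩)⟩
    · rw [← hz, Finset.mem_insert]
      tauto
    · rw [hx, Finset.mem_insert]
      tauto
    · change insert b x.1 = insert a z.1
      rw [hx, ← hz, Finset.insert_comm]
  · rintro x y z ⟨hzJ, ha, hy⟩ hxy hxz hx
    rw [hmem] at hx
    obtain ⟨b, hb, hby⟩ := Finset.covBy_iff_exists_insert.1 (I.covBy_coe hxy)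
    have hax : a ∈ x.1 := by
      by_contra hax
      have hay : a ∈ insert b x.1 := by
        rw [hby, hy]
        exact Finset.mem_insert_self a z.1
      obtain rfl : a = b := (Finset.mem_insert.1 hay).resolve_right hax
      refine hxz (Subtype.ext ?_)
      rw [← Finset.erase_insert hax, ← Finset.erase_insert ha, hby, hy]
    have hab : a ≠ b := by
      rintro rfl
      exact hb hax
    refine ⟨⟨x.1.erase a, I.lower (Finset.erase_subset a x.1) x.2⟩,
      ⟨herase x.1 x.2 hx, Finset.notMem_erase a x.1, (Finset.insert_erase hax).symm⟩,
      I.covBy_coe_iff.1 (Finset.covBy_iff_exists_insert.2 ⟨b, fun h => hb (Finset.mem_of_mem_erase h),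
        ?_⟩)⟩
    rw [← Finset.erase_insert_of_ne hab.symm, hby, hy, Finset.erase_insert ha]

/-! ### Broken circuits and spanned edges -/

namespace SimpleGraph

variable {V : Type u} {G : SimpleGraph V}

theorem componentSetoid_le_iff {T : Finset G.edgeSet} {π : Setoid V} :
    G.componentSetoid T ≤ π ↔ ∀ f ∈ T, ∀ x y, (f : Sym2 V) = s(x, y) → π x y := by
  constructor
  · intro h f hf x y hxy
    have hadj : G.Adj x y := by
      rw [← mem_edgeSet, ← hxy]
      exact f.2
    exact h (Adj.reachable ((fromEdgeSet_adj _).2 ⟨⟨f, hf, hxy⟩, hadj.ne⟩))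
  · rintro h x y ⟨p⟩
    induction p with
    | nil => exact π.refl _
    | cons hadj _ ih =>
      obtain ⟨⟨f, hf, hxy⟩, -⟩ := (fromEdgeSet_adj _).1 hadj
      exact π.trans (h f hf _ _ hxy) ih

variable [ord : LinearOrder G.edgeSet]

/-- The ends of `e` are joined by a path of edges in `T` that are smaller than `e`. -/
def IsSpannedBelow (T : Finset G.edgeSet) (e : G.edgeSet) : Prop :=
  ∀ x y, (e : Sym2 V) = s(x, y) → G.componentSetoid (T.filter (ord.lt · e)) x y

theorem IsSpannedBelow.mono {S T : Finset G.edgeSet} (h : S ⊆ T) {e : G.edgeSet}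
    (hS : IsSpannedBelow S e) : IsSpannedBelow T e := fun x y hxy =>
  G.componentSetoid_mono (Finset.filter_subset_filter _ h) (hS x y hxy)

theorem isSpannedBelow_erase_iff {T : Finset G.edgeSet} {e : G.edgeSet} :
    IsSpannedBelow (T.erase e) e ↔ IsSpannedBelow T e := by
  have : (T.erase e).filter (ord.lt · e) = T.filter (ord.lt · e) := by
    ext f
    simp only [Finset.mem_filter, Finset.mem_erase]
    exact ⟨fun h => ⟨h.1.2, h.2⟩, fun h => ⟨⟨@ne_of_lt _ ord.toPreorder _ _ h.2, h.1⟩, h.2⟩⟩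
  rw [IsSpannedBelow, IsSpannedBelow, this]

theorem IsSpannedBelow.componentSetoid_insert {T : Finset G.edgeSet} {e : G.edgeSet}
    (h : IsSpannedBelow T e) : G.componentSetoid (insert e T) = G.componentSetoid T := by
  refine le_antisymm (componentSetoid_le_iff.2 fun f hf x y hxy => ?_)
    (G.componentSetoid_mono (Finset.subset_insert e T))
  rcases Finset.mem_insert.1 hf with rfl | hf
  · exact G.componentSetoid_mono (Finset.filter_subset _ T) (h x y hxy)
  · exact componentSetoid_le_iff.1 le_rfl f hf x y hxy

/-- Circuit elimination: a path below `e` that uses `a` can be rerouted, as `a < e` is itself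
spanned below. -/
theorem IsSpannedBelow.of_insert {T : Finset G.edgeSet} {a e : G.edgeSet}
    (ha : IsSpannedBelow T a) (hae : ord.lt a e) (h : IsSpannedBelow (insert a T) e) :
    IsSpannedBelow T e := by
  intro x y hxy
  have ha' : IsSpannedBelow (T.filter (ord.lt · e)) a := by
    intro x y hxy
    refine G.componentSetoid_mono (fun f hf => ?_) (ha x y hxy)
    simp only [Finset.mem_filter] at hf ⊢
    exact ⟨⟨hf.1, @lt_trans _ ord.toPreorder _ _ _ hf.2 hae⟩, hf.2⟩
  have := h x y hxy
  rwa [Finset.filter_insert, if_pos hae, ha'.componentSetoid_insert] at this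

theorem exists_isBrokenCircuit_subset_iff {T : Finset G.edgeSet} :
    (∃ B, G.IsBrokenCircuit ord B ∧ B ⊆ T) ↔ ∃ e, IsSpannedBelow T e := by
  constructor
  -- Removing `e` from the graph `H` with edge set `C` does not disconnect its ends.
  · rintro ⟨B, ⟨C, e, ⟨u, p, hp, hC⟩, he, hmax, hB⟩, hBT⟩
    refine ⟨e, fun x y hxy => ?_⟩
    let H : SimpleGraph V := fromEdgeSet ((fun f : G.edgeSet => (f : Sym2 V)) '' C)
    have hH : ∀ f ∈ p.edges, f ∈ H.edgeSet := fun f hf => by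
      have hfG := p.edges_subset_edgeSet hf
      rw [edgeSet_fromEdgeSet]
      exact ⟨⟨⟨f, hfG⟩, (hC ⟨f, hfG⟩).2 hf, rfl⟩, G.not_isDiag_of_mem_edgeSet hfG⟩
    refine Reachable.mono ?_ (adj_and_reachable_delete_edges_iff_exists_cycle.2
      ⟨u, p.transfer H hH, hp.transfer hH, by
        rw [Walk.edges_transfer, ← hxy]
        exact (hC e).1 he⟩).2
    intro v w hvw
    obtain ⟨hvw, hne⟩ := deleteEdges_adj.1 hvw
    obtain ⟨⟨f, hf, hfvw⟩, hvw'⟩ := (fromEdgeSet_adj _).1 hvw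
    have hfe : f ≠ e := by
      rintro rfl
      exact hne (hfvw.symm.trans hxy)
    refine (fromEdgeSet_adj _).2 ⟨⟨f, ?_, hfvw⟩, hvw'⟩
    rw [Finset.mem_coe, Finset.mem_filter]
    exact ⟨hBT ((hB f).2 ⟨hf, hfe⟩), @lt_of_le_of_ne _ ord.toPartialOrder _ _ (hmax f hf) hfe⟩
  -- Conversely, the cycle is found in the subgraph `H` whose edges are `e` and the smaller edges
  -- of `T`, so that `e` is its largest edge.
  · rintro ⟨e, he⟩
    obtain ⟨x, y, hxy⟩ : ∃ x y, (e : Sym2 V) = s(x, y) :=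
      Sym2.ind (fun x y => ⟨x, y, rfl⟩) (e : Sym2 V)
    have hadj : G.Adj x y := by
      rw [← mem_edgeSet, ← hxy]
      exact e.2
    let S := insert e (T.filter (ord.lt · e))
    let H : SimpleGraph V := fromEdgeSet ((fun f : G.edgeSet => (f : Sym2 V)) '' S)
    have hHG : H ≤ G := by
      intro v w hvw
      obtain ⟨⟨f, -, hf⟩, -⟩ := (fromEdgeSet_adj _).1 hvw
      rw [← mem_edgeSet, ← hf]
      exact f.2
    have hS : ∀ f : G.edgeSet, (f : Sym2 V) ∈ H.edgeSet → f ∈ S := by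
      intro f hf
      rw [edgeSet_fromEdgeSet] at hf
      obtain ⟨⟨f', hf', hff'⟩, -⟩ := hf
      rwa [← Subtype.ext hff']
    obtain ⟨u, p, hp, hep⟩ := adj_and_reachable_delete_edges_iff_exists_cycle.1
      (show H.Adj x y ∧ (H.deleteEdges {s(x, y)}).Reachable x y from
        ⟨(fromEdgeSet_adj _).2 ⟨⟨e, Finset.mem_insert_self _ _, hxy⟩, hadj.ne⟩,
        Reachable.mono (fun v w hvw => by
          obtain ⟨⟨f, hf, hfvw⟩, hne⟩ := (fromEdgeSet_adj _).1 hvw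
          refine deleteEdges_adj.2 ⟨(fromEdgeSet_adj _).2
            ⟨⟨f, Finset.mem_insert_of_mem hf, hfvw⟩, hne⟩, fun hvwe => ?_⟩
          have hfe : f = e := Subtype.ext (hfvw.trans (hvwe.trans hxy.symm))
          exact @ne_of_lt _ ord.toPreorder _ _ (Finset.mem_filter.1 hf).2 hfe) (he x y hxy)⟩)
    let _ := Classical.decPred fun f : G.edgeSet => (f : Sym2 V) ∈ p.edges
    have hC : ∀ f : G.edgeSet, f ∈ S.filter (fun f : G.edgeSet => (f : Sym2 V) ∈ p.edges) ↔
        (f : Sym2 V) ∈ p.edges := fun f =>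
      ⟨fun h => (Finset.mem_filter.1 h).2, fun h =>
        Finset.mem_filter.2 ⟨hS f (p.edges_subset_edgeSet h), h⟩⟩
    refine ⟨(S.filter (fun f : G.edgeSet => (f : Sym2 V) ∈ p.edges)).erase e,
      ⟨S.filter (fun f : G.edgeSet => (f : Sym2 V) ∈ p.edges), e, ⟨u, p.mapLe hHG, ?_, ?_⟩, ?_, ?_, ?_⟩, ?_⟩
    · exact hp.mapLe hHG
    · intro f
      rw [hC, Walk.edges_mapLe_eq_edges]
    · rw [hC, hxy]
      exact hep
    · intro f hf
      rcases Finset.mem_insert.1 (Finset.mem_filter.1 hf).1 with rfl | hf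
      · exact ord.le_refl _
      · exact @le_of_lt _ ord.toPreorder _ _ (Finset.mem_filter.1 hf).2
    · intro f
      rw [Finset.mem_erase, and_comm]
    · intro f hf
      obtain ⟨hfe, hf⟩ := Finset.mem_erase.1 hf
      exact (Finset.mem_filter.1
        ((Finset.mem_insert.1 (Finset.mem_filter.1 hf).1).resolve_left hfe)).1

/-- The lower order ideal of the edge sets without a broken circuit whose deleted edge lies
in `s`. -/
def nbcOn (s : Finset G.edgeSet) : LowerSet (Finset G.edgeSet) where
  carrier := {T | ∀ e ∈ s, ¬ IsSpannedBelow T e}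
  lower' _ _ hST hT e he h := hT e he (h.mono hST)

theorem nbcOn_univ [Fintype G.edgeSet] : nbcOn Finset.univ = G.nbc ord := by
  ext T
  change (∀ e ∈ Finset.univ, ¬ IsSpannedBelow T e) ↔ ∀ B, G.IsBrokenCircuit ord B → ¬ B ⊆ T
  have := not_congr (exists_isBrokenCircuit_subset_iff (T := T))
  push Not at this
  simp only [Finset.mem_univ, true_imp_iff]
  exact this.symm

/-- If `e` is smaller than the edges in `s`, toggling `e` is an involution on the edge sets that
lie in `nbcOn s` but not in `nbcOn (insert e s)`, and it preserves the connected components. -/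
theorem nonempty_nbcOn_iso_nbcOn_insert [Fintype V] (c : BalancedColoring (Finset G.edgeSet))
    (e : G.edgeSet) (s : Finset G.edgeSet) (hs : ∀ f ∈ s, ord.lt e f) (i : ℕ) :
    Nonempty (posetCohomology (restrictToLowerSet (chromaticSymmetricFunctor G) (nbcOn s))
        (c.restrict (nbcOn s)) i ≅
      posetCohomology (restrictToLowerSet (chromaticSymmetricFunctor G) (nbcOn (insert e s)))
        (c.restrict (nbcOn (insert e s))) i) := by
  have hspan : ∀ T ∈ nbcOn s, T ∉ nbcOn (insert e s) → IsSpannedBelow T e := by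
    intro T hT hT'
    by_contra h
    refine hT' fun f hf => ?_
    rcases Finset.mem_insert.1 hf with rfl | hf
    · exact h
    · exact hT f hf
  refine Finset.nonempty_restrictToLowerSet_iso_of_toggle (chromaticSymmetricFunctor G) c
    (I := nbcOn s) (J := nbcOn (insert e s)) (fun T hT f hf => hT f (Finset.mem_insert_of_mem hf)) e ?_ ?_ ?_ i
  · intro T hT hT' f hf hspan'
    exact hT f hf ((hspan T hT hT').of_insert (hs f hf) hspan')
  · intro T hT hT' h
    exact h e (Finset.mem_insert_self e s) (isSpannedBelow_erase_iff.2 (hspan T hT hT'))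
  · intro T hT hT'
    have hle := (hspan T hT hT').componentSetoid_insert.le
    have : IsIso (G.componentSetoid_mono.functor.map (homOfLE (Finset.subset_insert e T))) :=
      ⟨homOfLE hle, Subsingleton.elim _ _, Subsingleton.elim _ _⟩
    exact inferInstanceAs (IsIso ((partitionFunctor V).map
      (G.componentSetoid_mono.functor.map (homOfLE (Finset.subset_insert e T)))))

end SimpleGraph

theorem mainTheorem4 {V : Type u} [Fintype V] (G : SimpleGraph V) (ord : LinearOrder G.edgeSet)
    (i : ℕ) :
    Nonempty
      (posetCohomology (chromaticSymmetricFunctor G) (booleanColoring ord) i ≅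
        posetCohomology (restrictToLowerSet (chromaticSymmetricFunctor G) (G.nbc ord))
          ((booleanColoring ord).restrict (G.nbc ord)) i) := by
  have : Fintype G.edgeSet := Fintype.ofFinite _
  rw [← SimpleGraph.nbcOn_univ]
  -- The edges deleted from the broken circuits are treated in decreasing order.
  induction (Finset.univ : Finset G.edgeSet) using Finset.induction_on_min with
  | empty =>
    exact nonempty_restrictToLowerSet_iso_of_forall_mem _ _ _
      (fun T e he => absurd he (Finset.notMem_empty e)) i
  | insert e s hs ih =>
    exact ih.elim fun α =>
      (SimpleGraph.nonempty_nbcOn_iso_nbcOn_insert (booleanColoring ord) e s hs i).map α.trans
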